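/- Let $K$ be a field and let $t\ge 2$ be an integer. A *run of length* $s\ge 1$ is the path complex of a line graph: the simplicial complex on $s+t-1$ vertices $x_1,\dots,x_{s+t-1}$ whose facets are the $s$ sets $\{x_k,x_{k+1},\dots,x_{k+t-1}\}$, $1\le k\le s$ (the vertex sets of the paths with $t$ vertices). For positive integers $s_1,\dots,s_r$ with $r\ge 1$, let $\Gamma$ be a disjoint union of runs of lengths $s_1,\dots,s_r$, with vertex set $Y$ and facets $F_1,\dots,F_m$, and let $$E(s_1,\dots,s_r)=\langle Y\setminus F_1,\dots,Y\setminus F_m\rangle$$ be the complement complex, i.e. the simplicial complex whose faces are all subsets (including $\emptyset$) of the sets $Y\setminus F_k$. Let $\widetilde H_i(-)$ denote the $i$-th reduced simplicial homology with coefficients in $K$, $i\in\mathbb Z$; thus $\widetilde H_{-1}(\{\emptyset\})\cong K$. (1) Let $\alpha,\beta\ge 0$ be integers with $\alpha+\beta\ge 1$, let $p_1,\dots,p_\alpha,q_1,\dots,q_\beta$ be nonnegative integers, and put $P=\sum_{j=1}^{\alpha}p_j$, $Q=\sum_{j=1}^{\beta}q_j$. For $$E=E\big((t+1)p_1+1,\dots,(t+1)p_\alpha+1,\,(t+1)q_1+2,\dots,(t+1)q_\beta+2\big)$$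 one has $$\widetilde H_i(E)\cong\begin{cases}K & \text{if } i=2(P+Q)+2\beta+\alpha-2,\\ 0&\text{otherwise.}\end{cases}$$ (2) For every other sequence of run lengths the homology vanishes: if $s_1,\dots,s_r$ are positive integers and some $s_j$ is congruent to neither $1$ nor $2$ modulo $t+1$, then $\widetilde H_i(E(s_1,\dots,s_r))=0$ for all $i\in\mathbb Z$. -/

import Mathlib

set_option maxSynthPendingDepth 3

/-- A simplicial complex with vertices taken from `V`: a family of finite
sets closed under passing to subsets.  The empty set is allowed as a face, so the void complex
(no faces at all) and the complex `{∅}` are different; points of `V` need not be vertices. -/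
abbrev FaceComplex (V : Type*) := LowerSet (Finset V)

namespace FaceComplex

/-- The facets: the faces that are maximal under inclusion. -/
def facets {V : Type*} (Δ : FaceComplex V) : Set (Finset V) :=
  {F | Maximal (fun G => G ∈ Δ) F}

/-- The vertex set. -/
def vertexSet {V : Type*} (Δ : FaceComplex V) : Set V :=
  {v | {v} ∈ Δ}

/-- The complement complex of `Δ` in its own vertex set `Y`: the simplicial complex generated by
the sets `Y \ F`, where `F` runs over the facets of `Δ`. -/
def complement {V : Type*} (Δ : FaceComplex V) : FaceComplex V where
  carrier := {G | ∃ F ∈ Δ.facets, (G : Set V) ⊆ Δ.vertexSet \ (F : Set V)}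
  lower' := by
    rintro G H hHG ⟨F, hF, hG⟩
    exact ⟨F, hF, subset_trans (Finset.coe_subset.mpr hHG) hG⟩

/-- The image of a complex under an injective map of vertices. -/
def map {V W : Type*} (f : V ↪ W) (Δ : FaceComplex V) : FaceComplex W :=
  lowerClosure {F | ∃ G ∈ Δ, F = G.map f}

/-- The disjoint union of a family of complexes, on the disjoint union of the vertex sets. -/
def disjointUnion {ι : Type*} {V : ι → Type*} (Δ : ∀ j, FaceComplex (V j)) :
    FaceComplex (Σ j, V j) :=
  lowerClosure {F | ∃ j, ∃ G ∈ Δ j, F = G.map (Function.Embedding.sigmaMk j)}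

/-- The path complex of a graph `G`: it is generated by the vertex sets of the paths of `G`
with `t` vertices (and hence `t - 1` edges). -/
def pathComplex {V : Type*} [DecidableEq V] (t : ℕ) (G : SimpleGraph V) : FaceComplex V :=
  lowerClosure {F | ∃ (u v : V) (w : G.Walk u v),
    w.IsPath ∧ w.length + 1 = t ∧ F = w.support.toFinset}

/-- The run of length `p`: the path complex of the line graph on `p + t - 1` vertices. -/
def run (t p : ℕ) : FaceComplex (Fin (p + t - 1)) :=
  pathComplex t (SimpleGraph.pathGraph (p + t - 1))

/-- `Γ` is, up to the names of its vertices, the disjoint union of runs of the lengths `s j`. -/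
def IsDisjointUnionOfRuns {ι V : Type*} (t : ℕ) (s : ι → ℕ) (Γ : FaceComplex V) : Prop :=
  ∃ f : (Σ j, Fin (s j + t - 1)) ↪ V, Γ = (disjointUnion fun j => run t (s j)).map f

section Homology

/-- The simplicial boundary map, on the vector space with basis all finite subsets of a linearly
ordered set: for `F = {v₀ < v₁ < ⋯ < vₘ}` it is `∂ F = ∑ₖ (-1)ᵏ (F \ {vₖ})`, and `∂ ∅ = 0`. -/
noncomputable def boundaryMap (K : Type*) [Field K] (V : Type*) [LinearOrder V] :
    (Finset V →₀ K) →ₗ[K] (Finset V →₀ K) :=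
  Finsupp.linearCombination K fun F : Finset V =>
    ∑ v ∈ F, Finsupp.single (F.erase v) ((-1 : K) ^ (F.filter fun u => u < v).card)

/-- The degree `i` part of the reduced chain complex: it has as basis the faces with `i + 1`
elements (so the empty face, if it is a face, spans degree `-1`). -/
def chains (K : Type*) [Field K] {V : Type*} (Δ : FaceComplex V) (i : ℤ) :
    Submodule K (Finset V →₀ K) :=
  Finsupp.supported K K {F | F ∈ Δ ∧ (F.card : ℤ) = i + 1}

/-- The `i`-cycles. -/
noncomputable def cycles (K : Type*) [Field K] {V : Type*} [LinearOrder V]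
    (Δ : FaceComplex V) (i : ℤ) : Submodule K (Finset V →₀ K) :=
  chains K Δ i ⊓ LinearMap.ker (boundaryMap K V)

/-- The `i`-boundaries. -/
noncomputable def boundaries (K : Type*) [Field K] {V : Type*} [LinearOrder V]
    (Δ : FaceComplex V) (i : ℤ) : Submodule K (Finset V →₀ K) :=
  (chains K Δ (i + 1)).map (boundaryMap K V)

/-- The `i`-th reduced homology with coefficients in `K`: cycles modulo boundaries. -/
abbrev ReducedHomology (K : Type*) [Field K] {V : Type*} [LinearOrder V]
    (Δ : FaceComplex V) (i : ℤ) :=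
  (↥(cycles K Δ i)) ⧸ ((boundaries K Δ i).submoduleOf (cycles K Δ i))

theorem boundaryMap_single (K : Type*) [Field K] {V : Type*} [LinearOrder V]
    (F : Finset V) (a : K) :
    boundaryMap K V (Finsupp.single F a) =
      a • ∑ v ∈ F, Finsupp.single (F.erase v) ((-1 : K) ^ (F.filter fun u => u < v).card) := by
  simp [boundaryMap]

theorem boundaryMap_boundaryMap (K : Type*) [Field K] {V : Type*} [LinearOrder V]
    (x : Finset V →₀ K) : boundaryMap K V (boundaryMap K V x) = 0 := by
  have key : ∀ (F : Finset V) (v w : V), v ∈ F → w ∈ F → v < w →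
      (-1 : K) ^ (F.filter fun u => u < w).card =
        - (-1 : K) ^ ((F.erase v).filter fun u => u < w).card ∧
      ((F.erase w).filter fun u => u < v) = (F.filter fun u => u < v) := by
    intro F v w hv hw hvw
    constructor
    · have h : ((F.erase v).filter fun u => u < w) = (F.filter fun u => u < w).erase v :=
        Finset.filter_erase _ _ _
      have hm : v ∈ F.filter fun u => u < w := by simp [hv, hvw]
      rw [h, ← Finset.card_erase_add_one hm, pow_succ]
      ring
    · ext u
      simp only [Finset.mem_filter, Finset.mem_erase]
      constructor
      · rintro ⟨⟨_, h1⟩, h2⟩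
        exact ⟨h1, h2⟩
      · rintro ⟨h1, h2⟩
        exact ⟨⟨(h2.trans hvw).ne, h1⟩, h2⟩
  have main : boundaryMap K V ∘ₗ boundaryMap K V = 0 := by
    refine Finsupp.lhom_ext fun F a => ?_
    simp only [LinearMap.comp_apply, boundaryMap_single, map_smul, map_sum, LinearMap.zero_apply]
    suffices h : ∑ v ∈ F, ((-1 : K) ^ (F.filter fun u => u < v).card) •
        ∑ w ∈ F.erase v, Finsupp.single ((F.erase v).erase w)
          ((-1 : K) ^ ((F.erase v).filter fun u => u < w).card) = 0 by
      rw [h, smul_zero]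
    simp only [Finset.smul_sum, Finsupp.smul_single, smul_eq_mul]
    rw [Finset.sum_sigma']
    refine Finset.sum_involution (fun x _ => ⟨x.2, x.1⟩) ?_ ?_ ?_ ?_
    · rintro ⟨v, w⟩ h
      simp only [Finset.mem_sigma, Finset.mem_erase] at h
      obtain ⟨hv, hne, hw⟩ := h
      simp only
      rw [Finset.erase_right_comm, ← Finsupp.single_add]
      rw [Finsupp.single_eq_zero]
      rcases lt_or_gt_of_ne hne with hlt | hlt
      · obtain ⟨h1, h2⟩ := key F w v hw hv hlt
        rw [h1, h2]
        ring
      · obtain ⟨h1, h2⟩ := key F v w hv hw hlt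
        rw [h1, h2]
        ring
    · rintro ⟨v, w⟩ h _ heq
      simp only [Finset.mem_sigma, Finset.mem_erase] at h
      simp only [Sigma.mk.injEq] at heq
      exact h.2.1 heq.1
    · rintro ⟨v, w⟩ h
      simp only [Finset.mem_sigma, Finset.mem_erase] at h ⊢
      exact ⟨h.2.2, h.2.1.symm, h.1⟩
    · rintro ⟨v, w⟩ _
      rfl
  exact LinearMap.congr_fun main x

theorem boundaries_le_cycles (K : Type*) [Field K] {V : Type*} [LinearOrder V]
    (Δ : FaceComplex V) (i : ℤ) : boundaries K Δ i ≤ cycles K Δ i := by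
  rintro _ ⟨x, hx, rfl⟩
  refine ⟨?_, boundaryMap_boundaryMap K x⟩
  have hx' : x ∈ Finsupp.supported K K {F | F ∈ Δ ∧ (F.card : ℤ) = i + 1 + 1} := hx
  rw [Finsupp.supported_eq_span_single] at hx'
  induction hx' using Submodule.span_induction with
  | zero => simp
  | add y z _ _ h1 h2 =>
    rw [map_add]
    refine Submodule.add_mem _ (h1 ?_) (h2 ?_) <;>
    · change _ ∈ Finsupp.supported K K {F | F ∈ Δ ∧ (F.card : ℤ) = i + 1 + 1}
      rw [Finsupp.supported_eq_span_single]
      assumption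
  | smul a y _ h =>
    rw [map_smul]
    refine Submodule.smul_mem _ _ (h ?_)
    change _ ∈ Finsupp.supported K K {F | F ∈ Δ ∧ (F.card : ℤ) = i + 1 + 1}
    rw [Finsupp.supported_eq_span_single]
    assumption
  | mem y hy =>
    obtain ⟨F, ⟨hF, hc⟩, rfl⟩ := hy
    simp only [boundaryMap_single, one_smul]
    refine Submodule.sum_mem _ fun v hv => ?_
    refine Finsupp.single_mem_supported K _ ⟨Δ.lower (Finset.erase_subset v F) hF, ?_⟩
    have := Finset.card_erase_add_one hv
    omega

end Homology

end FaceComplex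

/-! Inside the full simplex on `Y`, a set `G` is a non-face of `E` exactly when it meets every
facet, that is, every block of `t` consecutive vertices of every run. The simplex is acyclic (`Y` is
nonempty), so the homology of `E` in degree `m` is that of the pair (simplex, `E`) in degree `m +
1`, and this depends only on the family of hitting sets. The family is thinned by discarding pairs
`F`, `F ∪ {v}`: such a discard is harmless if the remaining family is a lower or an upper part of
the old one (`reducesTo_of_lower`, `reducesTo_of_upper`, both resting on `exactAt_of_cone`).

Take a run of length at least two on `x 0, x 1, …`. If `x t ∉ G`, whatever hits the second block
also hits the first, so `x 0` may be toggled freely; hence assume `x t ∈ G`. That vertex hits blocks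
`1, …, t` and leaves the first block together with a run of length `s - (t + 1)` behind it. In the
first block `x (t - 1)` may be toggled whenever another vertex of the block is present, so only the
trace `{x (t - 1)}` survives. Thus `t + 1` vertices are used up and two of them are kept
(`reducesTo_hits_tail`).

Iterating, a run ends at length `1` (one vertex kept), at length `2` (two kept, none left over), or
at a length from `3` to `t + 1`, where a vertex remains free and everything cancels. Doing this for
all runs leaves either nothing or a single set of size `∑ (2 ⌊s / (t + 1)⌋ + s mod (t + 1))`; its
relative class sits in degree size `- 1`, hence in degree size `- 2` for `E`. -/

namespace FaceComplex

/-! ### Relative simplicial homology at chain level. -/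

section RelativeHomology

variable {K : Type*} [Field K] {V : Type*}

theorem chains_mono {M U : FaceComplex V} (h : M ≤ U) (m : ℤ) : chains K M m ≤ chains K U m :=
  Finsupp.supported_mono fun _ hF => ⟨h hF.1, hF.2⟩

/-- When `U` and `M` differ only by the face `G`, a chain of `U` lies in `M` up to its coefficient
at `G`. -/
theorem chains_sub_single_mem {U M : FaceComplex V} {G : Finset V}
    (hS : ∀ F, F ∈ ({G} : Set (Finset V)) ↔ F ∈ U ∧ F ∉ M) {m : ℤ} {x : Finset V →₀ K}
    (hx : x ∈ chains K U m) : x - Finsupp.single G (x G) ∈ chains K M m := by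
  intro F hF
  rw [Finset.mem_coe, Finsupp.mem_support_iff, Finsupp.sub_apply] at hF
  rcases eq_or_ne F G with rfl | hFG
  · simp at hF
  · rw [Finsupp.single_eq_of_ne hFG, sub_zero, ← Finsupp.mem_support_iff] at hF
    have := hx hF
    exact ⟨by_contra fun h => hFG ((hS F).2 ⟨this.1, h⟩), this.2⟩

theorem chains_bot {m : ℤ} : chains K (⊥ : FaceComplex V) m = ⊥ := by
  have : {F : Finset V | F ∈ (⊥ : FaceComplex V) ∧ (F.card : ℤ) = m + 1} = ∅ := by
    ext F
    simp
  rw [chains, this, Finsupp.supported_empty]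

variable [LinearOrder V]

theorem boundaryMap_mem_chains {U : FaceComplex V} {m : ℤ} {x : Finset V →₀ K}
    (hx : x ∈ chains K U (m + 1)) : boundaryMap K V x ∈ chains K U m :=
  (boundaries_le_cycles K U m ⟨x, hx, rfl⟩).1

theorem boundaryMap_mem_chains_sub_one {U : FaceComplex V} {m : ℤ} {x : Finset V →₀ K}
    (hx : x ∈ chains K U m) : boundaryMap K V x ∈ chains K U (m - 1) :=
  boundaryMap_mem_chains (by simpa using hx)

variable (K) in
/-- The relative homology of the pair `(U, M)` vanishes in degree `m`. -/
def ExactAt (U M : FaceComplex V) (m : ℤ) : Prop :=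
  ∀ x ∈ chains K U m, boundaryMap K V x ∈ chains K M (m - 1) →
    ∃ y ∈ chains K U (m + 1), x - boundaryMap K V y ∈ chains K M m

variable (K) in
/-- The relative homology of the pair `(U, M)` is one-dimensional in degree `m`. -/
def OneDimAt (U M : FaceComplex V) (m : ℤ) : Prop :=
  ∃ z ∈ chains K U m, boundaryMap K V z ∈ chains K M (m - 1) ∧
    (∀ y ∈ chains K U (m + 1), z - boundaryMap K V y ∉ chains K M m) ∧
    ∀ x ∈ chains K U m, boundaryMap K V x ∈ chains K M (m - 1) →
      ∃ c : K, ∃ y ∈ chains K U (m + 1), x - c • z - boundaryMap K V y ∈ chains K M m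

/-- A correction by a boundary does not change the boundary. -/
theorem boundaryMap_sub_boundaryMap (x y : Finset V →₀ K) :
    boundaryMap K V (x - boundaryMap K V y) = boundaryMap K V x := by
  rw [map_sub, boundaryMap_boundaryMap, sub_zero]

/-! ### Consequences of the long exact sequence of a triple. -/

section Triple

variable {L M U : FaceComplex V} {m : ℤ}

/-- When `(U, M)` is acyclic, the inclusion of `(M, L)` into `(U, L)` is an isomorphism on homology:
relative cycles can be pushed down into `M`. The next lemma is the one-dimensional version. -/
theorem ExactAt.of_upper (hMU : M ≤ U) (hLM : L ≤ M)
    (hac : ∀ n, ExactAt K U M n) (h : ExactAt K M L m) : ExactAt K U L m := by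
  intro x hx hdx
  obtain ⟨y, hy, hxy⟩ := hac m x hx (chains_mono hLM _ hdx)
  obtain ⟨w, hw, hxw⟩ := h _ hxy (by rwa [boundaryMap_sub_boundaryMap])
  refine ⟨y + w, add_mem hy (chains_mono hMU _ hw), ?_⟩
  rwa [map_add, ← sub_sub]

theorem OneDimAt.of_upper (hMU : M ≤ U) (hLM : L ≤ M)
    (hac : ∀ n, ExactAt K U M n) (h : OneDimAt K M L m) : OneDimAt K U L m := by
  obtain ⟨z, hz, hdz, hne, hgen⟩ := h
  refine ⟨z, chains_mono hMU _ hz, hdz, ?_, ?_⟩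
  · intro y hy hzy
    have hdy : boundaryMap K V y ∈ chains K M (m + 1 - 1) := by
      rw [add_sub_cancel_right]
      simpa using sub_mem hz (chains_mono hLM _ hzy)
    obtain ⟨w, -, hyw⟩ := hac _ y hy hdy
    exact hne _ hyw (by rwa [boundaryMap_sub_boundaryMap])
  · intro x hx hdx
    obtain ⟨y, hy, hxy⟩ := hac m x hx (chains_mono hLM _ hdx)
    obtain ⟨c, w, hw, hxw⟩ := hgen _ hxy (by rwa [boundaryMap_sub_boundaryMap])
    refine ⟨c, y + w, add_mem hy (chains_mono hMU _ hw), ?_⟩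
    rw [map_add]
    convert hxw using 1
    abel

/-- Dually, when `(M, L)` is acyclic, `(U, L)` and `(U, M)` have the same homology. -/
theorem ExactAt.of_lower (hMU : M ≤ U)
    (hac : ∀ n, ExactAt K M L n) (h : ExactAt K U M m) (hLM : L ≤ M) : ExactAt K U L m := by
  intro x hx hdx
  obtain ⟨y, hy, hxy⟩ := h x hx (chains_mono hLM _ hdx)
  obtain ⟨w, hw, hxw⟩ := hac m _ hxy (by rwa [boundaryMap_sub_boundaryMap])
  refine ⟨y + w, add_mem hy (chains_mono hMU _ hw), ?_⟩
  rwa [map_add, ← sub_sub]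

theorem OneDimAt.of_lower (hMU : M ≤ U) (hLM : L ≤ M)
    (hac : ∀ n, ExactAt K M L n) (h : OneDimAt K U M m) : OneDimAt K U L m := by
  obtain ⟨z, hz, hdz, hne, hgen⟩ := h
  -- The boundary of `z` is a cycle of `M`, hence bounds modulo `L`; subtracting `w` makes `z` a
  -- cycle relative to `L`.
  obtain ⟨w, hw, hzw⟩ := hac (m - 1) _ hdz (by rw [boundaryMap_boundaryMap]; exact zero_mem _)
  rw [sub_add_cancel] at hw
  rw [← map_sub] at hzw
  refine ⟨z - w, sub_mem hz (chains_mono hMU _ hw), hzw, ?_, ?_⟩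
  · intro y hy hzy
    refine hne y hy ?_
    convert add_mem (chains_mono hLM _ hzy) hw using 1
    abel
  · intro x hx hdx
    obtain ⟨c, y, hy, hxy⟩ := hgen x hx (chains_mono hLM _ hdx)
    have hxy' : x - c • (z - w) - boundaryMap K V y ∈ chains K M m := by
      convert add_mem hxy (Submodule.smul_mem _ c hw) using 1
      rw [smul_sub]
      abel
    obtain ⟨u, hu, hxu⟩ := hac m _ hxy' (by
      rw [boundaryMap_sub_boundaryMap, map_sub, map_smul]
      exact sub_mem hdx (Submodule.smul_mem _ c hzw))
    refine ⟨c, y + u, add_mem hy (chains_mono hMU _ hu), ?_⟩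
    rw [map_add]
    convert hxu using 1
    abel

/-- When `(U, L)` is acyclic, the connecting map from degree `m + 1` of `(U, M)` to degree `m` of
`(M, L)` is an isomorphism. It is induced by the boundary, which supplies the generator in the
one-dimensional version below. -/
theorem ExactAt.shift (hLM : L ≤ M)
    (hac : ∀ n, ExactAt K U L n) (hMU : M ≤ U) (h : ExactAt K U M (m + 1)) :
    ExactAt K M L m := by
  intro x hx hdx
  obtain ⟨y, hy, hxy⟩ := hac m x (chains_mono hMU _ hx) hdx
  have hdy : boundaryMap K V y ∈ chains K M (m + 1 - 1) := by
    rw [add_sub_cancel_right]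
    simpa using sub_mem hx (chains_mono hLM _ hxy)
  obtain ⟨w, -, hyw⟩ := h y hy hdy
  exact ⟨_, hyw, by rwa [boundaryMap_sub_boundaryMap]⟩

theorem OneDimAt.shift (hMU : M ≤ U) (hLM : L ≤ M)
    (hac : ∀ n, ExactAt K U L n) (h : OneDimAt K U M (m + 1)) : OneDimAt K M L m := by
  obtain ⟨z, hz, hdz, hne, hgen⟩ := h
  rw [add_sub_cancel_right] at hdz
  refine ⟨boundaryMap K V z, hdz, by rw [boundaryMap_boundaryMap]; exact zero_mem _, ?_, ?_⟩
  · intro y hy hzy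
    obtain ⟨w, hw, hzw⟩ := hac (m + 1) (z - y) (sub_mem hz (chains_mono hMU _ hy))
      (by rwa [add_sub_cancel_right, map_sub])
    refine hne w hw ?_
    convert add_mem (chains_mono hLM _ hzw) hy using 1
    abel
  · intro x hx hdx
    obtain ⟨y, hy, hxy⟩ := hac m x (chains_mono hMU _ hx) hdx
    have hdy : boundaryMap K V y ∈ chains K M (m + 1 - 1) := by
      rw [add_sub_cancel_right]
      simpa using sub_mem hx (chains_mono hLM _ hxy)
    obtain ⟨c, w, -, hyw⟩ := hgen y hy hdy
    refine ⟨c, _, hyw, ?_⟩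
    rw [boundaryMap_sub_boundaryMap, map_sub, map_smul]
    convert hxy using 1
    abel

end Triple

/-! ### Cones and matchings along a vertex. -/

section Cone

variable (K) in
/-- The cone operator with apex `v`: it sends a face `F` not containing `v` to `± (F ∪ {v})`. -/
noncomputable def coneMap (v : V) : (Finset V →₀ K) →ₗ[K] (Finset V →₀ K) :=
  Finsupp.linearCombination K fun F : Finset V =>
    if v ∈ F then 0 else Finsupp.single (insert v F) ((-1 : K) ^ (F.filter fun u => u < v).card)

theorem coneMap_single_of_mem {v : V} {F : Finset V} (h : v ∈ F) (a : K) :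
    coneMap K v (Finsupp.single F a) = 0 := by
  simp [coneMap, h]

theorem coneMap_single_of_notMem {v : V} {F : Finset V} (h : v ∉ F) (a : K) :
    coneMap K v (Finsupp.single F a) =
      Finsupp.single (insert v F) (a * (-1 : K) ^ (F.filter fun u => u < v).card) := by
  simp [coneMap, h]

theorem neg_one_pow_mul_self (n : ℕ) : (-1 : K) ^ n * (-1 : K) ^ n = 1 := by
  rw [← mul_pow]; simp

theorem neg_one_pow_insert_erase {v w : V} {F : Finset V} (hv : v ∉ F) (hw : w ∈ F) :
    (-1 : K) ^ (F.filter fun u => u < v).card *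
        (-1 : K) ^ ((insert v F).filter fun u => u < w).card +
      (-1 : K) ^ (F.filter fun u => u < w).card *
        (-1 : K) ^ ((F.erase w).filter fun u => u < v).card = 0 := by
  have hne : w ≠ v := fun h => hv (h ▸ hw)
  rw [Finset.filter_insert, Finset.filter_erase]
  rcases lt_or_gt_of_ne hne with h | h
  · have hm : w ∈ F.filter fun u => u < v := by simp [hw, h]
    rw [if_neg h.not_gt, ← Finset.card_erase_add_one hm, pow_succ]
    ring
  · have hm : v ∉ F.filter fun u => u < w := by simp [hv]
    have hm' : w ∉ F.filter fun u => u < v := by simp [h.le]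
    rw [if_pos h, Finset.card_insert_of_notMem hm, Finset.erase_eq_of_notMem hm', pow_succ]
    ring

/-- The cone operator is a contracting homotopy: its sign is the one with which the boundary removes
`v` again, and the remaining terms cancel in pairs by `neg_one_pow_insert_erase`. -/
theorem boundaryMap_coneMap_add (v : V) (x : Finset V →₀ K) :
    boundaryMap K V (coneMap K v x) + coneMap K v (boundaryMap K V x) = x := by
  have main : boundaryMap K V ∘ₗ coneMap K v + coneMap K v ∘ₗ boundaryMap K V =
      LinearMap.id := by
    refine Finsupp.lhom_ext fun F a => ?_
    simp only [LinearMap.add_apply, LinearMap.comp_apply, LinearMap.id_apply]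
    rw [boundaryMap_single K F a, map_smul, map_sum]
    by_cases hv : v ∈ F
    · rw [coneMap_single_of_mem hv, map_zero, zero_add, Finset.sum_eq_single v]
      · rw [coneMap_single_of_notMem (by simp), Finset.insert_erase hv, Finset.filter_erase,
          Finset.erase_eq_of_notMem (by simp), neg_one_pow_mul_self]
        simp
      · intro w _ hwv
        exact coneMap_single_of_mem (by simp [hv, hwv.symm]) _
      · exact fun h => absurd hv h
    · rw [coneMap_single_of_notMem hv, boundaryMap_single, Finset.sum_insert hv,
        Finset.erase_insert hv, Finset.filter_insert, if_neg (lt_irrefl v), mul_smul, ← smul_add a,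
        smul_add ((-1 : K) ^ _), add_assoc, Finset.smul_sum, ← Finset.sum_add_distrib, Finset.sum_eq_zero]
      · simp [neg_one_pow_mul_self]
      · intro w hw
        have hne : w ≠ v := fun h => hv (h ▸ hw)
        rw [coneMap_single_of_notMem (fun h => hv (Finset.mem_of_mem_erase h)),
          Finset.erase_insert_of_ne hne.symm, Finsupp.smul_single, smul_eq_mul,
          ← Finsupp.single_add, neg_one_pow_insert_erase hv hw, Finsupp.single_zero]
  exact LinearMap.congr_fun main x

theorem coneMap_mem_supported {v : V} {s t : Set (Finset V)}
    (h : ∀ F ∈ s, v ∉ F → insert v F ∈ t) {x : Finset V →₀ K}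
    (hx : x ∈ Finsupp.supported K K s) : coneMap K v x ∈ Finsupp.supported K K t := by
  rw [coneMap, Finsupp.linearCombination_apply]
  refine Submodule.sum_mem _ fun F hF => Submodule.smul_mem _ _ ?_
  split_ifs with hv
  · exact zero_mem _
  · exact Finsupp.single_mem_supported K _ (h F (hx hF) hv)

/-- If the faces of `U` outside `M` come in pairs `F`, `F ∪ {v}`, then the pair `(U, M)` has no
homology. -/
theorem exactAt_of_cone {U M : FaceComplex V} (v : V)
    (hins : ∀ F ∈ U, F ∉ M → insert v F ∈ U)
    (hers : ∀ F ∈ U, F ∉ M → F.erase v ∉ M) (m : ℤ) : ExactAt K U M m := by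
  classical
  intro x hx hdx
  -- Only the part of `x` outside `M` is coned off, since `hins` says nothing about the faces in
  -- `M`.
  set r := x.filter (fun F => F ∉ M) with hr
  have hxr : x - r ∈ chains K M m := by
    have hpos := Finsupp.filter_add_filter_not x (fun F => F ∉ M)
    rw [← hr] at hpos
    have : x - r = x.filter (fun F => ¬ F ∉ M) := by
      nth_rewrite 1 [← hpos]
      abel
    rw [this]
    intro F hF
    rw [Finset.mem_coe, Finsupp.support_filter, Finset.mem_filter, not_not] at hF
    exact ⟨hF.2, (hx hF.1).2⟩
  have hrs : r ∈ Finsupp.supported K K {F | (F ∈ U ∧ (F.card : ℤ) = m + 1) ∧ F ∉ M} := by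
    intro F hF
    rw [Finset.mem_coe, hr, Finsupp.support_filter, Finset.mem_filter] at hF
    exact ⟨hx hF.1, hF.2⟩
  have hrU : r ∈ chains K U m := Finsupp.supported_mono (fun F hF => hF.1) hrs
  have hy : coneMap K v r ∈ chains K U (m + 1) := by
    refine coneMap_mem_supported ?_ hrs
    rintro F ⟨⟨hFU, hc⟩, hFM⟩ hv
    refine ⟨hins F hFU hFM, ?_⟩
    rw [Finset.card_insert_of_notMem hv]
    push_cast
    linarith
  refine ⟨coneMap K v r, hy, ?_⟩
  have hdr : boundaryMap K V r ∈ chains K M (m - 1) := by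
    have := sub_mem hdx (boundaryMap_mem_chains_sub_one hxr)
    rwa [← map_sub, sub_sub_cancel] at this
  have hrest : r - boundaryMap K V (coneMap K v r) = coneMap K v (boundaryMap K V r) := by
    nth_rewrite 1 [← boundaryMap_coneMap_add v r]
    abel
  have hU : coneMap K v (boundaryMap K V r) ∈ chains K U m := by
    rw [← hrest]
    exact sub_mem hrU (boundaryMap_mem_chains hy)
  -- The error term is a cone over faces of `M`. Its faces lie in `U`, and erasing `v` lands in `M`,
  -- so `hers` forces them into `M`.
  have hM : coneMap K v (boundaryMap K V r) ∈
      Finsupp.supported K K {F : Finset V | F.erase v ∈ M} := by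
    refine coneMap_mem_supported ?_ hdr
    rintro F ⟨hFM, -⟩ hv
    simpa [Finset.erase_insert hv] using hFM
  have hc : coneMap K v (boundaryMap K V r) ∈ chains K M m := by
    intro F hF
    obtain ⟨hFU, hcard⟩ := hU hF
    exact ⟨by_contra fun h => hers F hFU h (hM hF), hcard⟩
  rw [← hrest] at hc
  convert add_mem hxr hc using 1
  abel

end Cone

/-! ### Homology of a difference of complexes and its reductions. -/

section Families

variable (K) in
/-- The homology of the difference `U \ M` of two complexes vanishes in degree `m`, for all ways
to write the family `S` as such a difference. -/
def FamilyExactAt (S : Set (Finset V)) (m : ℤ) : Prop :=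
  ∀ U M : FaceComplex V, M ≤ U → (∀ F, F ∈ S ↔ F ∈ U ∧ F ∉ M) → ExactAt K U M m

variable (K) in
/-- The homology of the difference `U \ M` of two complexes is one-dimensional in degree `m`, for
all ways to write the family `S` as such a difference. -/
def FamilyOneDimAt (S : Set (Finset V)) (m : ℤ) : Prop :=
  ∀ U M : FaceComplex V, M ≤ U → (∀ F, F ∈ S ↔ F ∈ U ∧ F ∉ M) → OneDimAt K U M m

variable (K) in
/-- What is known about the homology of the family `A` carries over to the family `S`. -/
def ReducesTo (S A : Set (Finset V)) : Prop :=
  ∀ m, (FamilyExactAt K A m → FamilyExactAt K S m) ∧ (FamilyOneDimAt K A m → FamilyOneDimAt K S m)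

theorem ReducesTo.refl (S : Set (Finset V)) : ReducesTo K S S := fun _ => ⟨id, id⟩

theorem ReducesTo.trans {S A B : Set (Finset V)} (h : ReducesTo K S A) (h' : ReducesTo K A B) :
    ReducesTo K S B :=
  fun m => ⟨fun hB => (h m).1 ((h' m).1 hB), fun hB => (h m).2 ((h' m).2 hB)⟩

/-- Adding the lower part `A` to `M` gives an intermediate complex `N`, and the faces of `U` outside
`N` are matched along `v`. -/
theorem reducesTo_of_lower {S A : Set (Finset V)} (hAS : A ⊆ S)
    (hlow : ∀ F ∈ A, ∀ G ∈ S, G ⊆ F → G ∈ A) (v : V)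
    (hins : ∀ F ∈ S, F ∉ A → insert v F ∈ S \ A)
    (hers : ∀ F ∈ S, F ∉ A → F.erase v ∈ S \ A) : ReducesTo K S A := by
  have key : ∀ U M : FaceComplex V, M ≤ U → (∀ F, F ∈ S ↔ F ∈ U ∧ F ∉ M) →
      ∃ N : FaceComplex V, M ≤ N ∧ N ≤ U ∧ (∀ F, F ∈ A ↔ F ∈ N ∧ F ∉ M) ∧
        ∀ n, ExactAt K U N n := by
    intro U M hMU hS
    have hN : ∀ F, F ∈ U → (F ∉ M ∧ F ∉ A ↔ F ∈ S \ A) := by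
      intro F hF
      simp [hS, hF]
    let N : FaceComplex V := ⟨{F | F ∈ M ∨ F ∈ A}, by
      rintro F G hGF (hF | hF)
      · exact Or.inl (M.lower hGF hF)
      · by_cases hG : G ∈ M
        · exact Or.inl hG
        · exact Or.inr (hlow F hF G ((hS G).2 ⟨U.lower hGF ((hS F).1 (hAS hF)).1, hG⟩) hGF)⟩
    have hmem : ∀ F, F ∈ N ↔ F ∈ M ∨ F ∈ A := fun F => Iff.rfl
    have hNU : N ≤ U := by
      rintro F (hF | hF)
      exacts [hMU hF, ((hS F).1 (hAS hF)).1]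
    refine ⟨N, fun F hF => Or.inl hF, hNU, fun F => ?_, exactAt_of_cone v ?_ ?_⟩
    · have := fun h => (hS F).1 (hAS h)
      rw [hmem]
      tauto
    · intro F hF hFN
      rw [hmem, not_or] at hFN
      exact ((hS _).1 (hins F ((hS F).2 ⟨hF, hFN.1⟩) hFN.2).1).1
    · intro F hF hFN
      rw [hmem, not_or] at hFN ⊢
      have := hers F ((hS F).2 ⟨hF, hFN.1⟩) hFN.2
      exact ⟨((hS _).1 this.1).2, this.2⟩
  refine fun m => ⟨fun h U M hMU hS => ?_, fun h U M hMU hS => ?_⟩ <;>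
  obtain ⟨N, hMN, hNU, hA, hac⟩ := key U M hMU hS
  · exact ExactAt.of_upper hNU hMN hac (h N M hMN hA)
  · exact OneDimAt.of_upper hNU hMN hac (h N M hMN hA)

/-- Here the intermediate complex is `U` with the upper part `A` removed, and the matched faces lie
between `M` and it. -/
theorem reducesTo_of_upper {S A : Set (Finset V)} (hAS : A ⊆ S)
    (hup : ∀ F ∈ A, ∀ G ∈ S, F ⊆ G → G ∈ A) (v : V)
    (hins : ∀ F ∈ S, F ∉ A → insert v F ∈ S \ A)
    (hers : ∀ F ∈ S, F ∉ A → F.erase v ∈ S \ A) : ReducesTo K S A := by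
  have key : ∀ U M : FaceComplex V, M ≤ U → (∀ F, F ∈ S ↔ F ∈ U ∧ F ∉ M) →
      ∃ N : FaceComplex V, M ≤ N ∧ N ≤ U ∧ (∀ F, F ∈ A ↔ F ∈ U ∧ F ∉ N) ∧
        ∀ n, ExactAt K N M n := by
    intro U M hMU hS
    let N : FaceComplex V := ⟨{F | F ∈ U ∧ F ∉ A}, by
      rintro F G hGF ⟨hF, hFA⟩
      refine ⟨U.lower hGF hF, fun hG => hFA (hup G hG F ((hS F).2 ⟨hF, fun hFM => ?_⟩) hGF)⟩
      exact ((hS G).1 (hAS hG)).2 (M.lower hGF hFM)⟩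
    have hmem : ∀ F, F ∈ N ↔ F ∈ U ∧ F ∉ A := fun F => Iff.rfl
    have hMN : M ≤ N := fun F hF => ⟨hMU hF, fun hA => ((hS F).1 (hAS hA)).2 hF⟩
    refine ⟨N, hMN, fun F hF => hF.1, fun F => ?_, exactAt_of_cone v ?_ ?_⟩
    · have := fun h => (hS F).1 (hAS h)
      rw [hmem]
      tauto
    · intro F hF hFM
      have := hins F ((hS F).2 ⟨hF.1, hFM⟩) hF.2
      exact ⟨((hS _).1 this.1).1, this.2⟩
    · intro F hF hFM
      exact ((hS _).1 (hers F ((hS F).2 ⟨hF.1, hFM⟩) hF.2).1).2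
  refine fun m => ⟨fun h U M hMU hS => ?_, fun h U M hMU hS => ?_⟩ <;>
  obtain ⟨N, hMN, hNU, hA, hac⟩ := key U M hMU hS
  · exact ExactAt.of_lower hNU hac (h U N hNU hA) hMN
  · exact OneDimAt.of_lower hNU hMN hac (h U N hNU hA)

theorem familyExactAt_empty (m : ℤ) : FamilyExactAt K (∅ : Set (Finset V)) m := by
  intro U M hMU hS x hx _
  refine ⟨0, zero_mem _, ?_⟩
  have hUM : U ≤ M := fun F hF => by_contra fun h => (hS F).2 ⟨hF, h⟩
  simpa using chains_mono hUM _ hx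

theorem familyExactAt_singleton (G : Finset V) {m : ℤ} (hm : m ≠ (G.card : ℤ) - 1) :
    FamilyExactAt K ({G} : Set (Finset V)) m := by
  intro U M hMU hS x hx _
  refine ⟨0, zero_mem _, ?_⟩
  have hxG : x G = 0 := by
    by_contra h
    have := (hx (Finsupp.mem_support_iff.2 h)).2
    omega
  simpa [hxG] using chains_sub_single_mem hS hx

theorem familyOneDimAt_singleton (G : Finset V) :
    FamilyOneDimAt K ({G} : Set (Finset V)) ((G.card : ℤ) - 1) := by
  intro U M hMU hS
  have hG := (hS G).1 rfl
  have hz : Finsupp.single G (1 : K) ∈ chains K U ((G.card : ℤ) - 1) :=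
    Finsupp.single_mem_supported K _ ⟨hG.1, by ring⟩
  refine ⟨_, hz, ?_, ?_, ?_⟩
  · have hd := boundaryMap_mem_chains_sub_one hz
    intro F hF
    have hF' := hd hF
    refine ⟨by_contra fun h => ?_, hF'.2⟩
    obtain rfl : F = G := (hS F).2 ⟨hF'.1, h⟩
    have := hF'.2
    omega
  · intro y hy hzy
    have hyM : y ∈ chains K M ((G.card : ℤ) - 1 + 1) := by
      have hyG : y G = 0 := by
        by_contra h
        have := (hy (Finsupp.mem_support_iff.2 h)).2
        omega
      simpa [hyG] using chains_sub_single_mem hS hy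
    have hzM : Finsupp.single G (1 : K) ∈ chains K M ((G.card : ℤ) - 1) := by
      simpa using add_mem hzy (boundaryMap_mem_chains hyM)
    exact hG.2 (hzM (by simp : G ∈ _)).1
  · intro x hx _
    refine ⟨x G, 0, zero_mem _, ?_⟩
    simpa using chains_sub_single_mem hS hx

end Families

/-! ### Reduced homology as homology relative to the void complex. -/

section Absolute

variable {Δ : FaceComplex V} {m : ℤ}

theorem subsingleton_reducedHomology (h : ExactAt K Δ ⊥ m) :
    Subsingleton (ReducedHomology K Δ m) := by
  rw [Submodule.Quotient.subsingleton_iff, eq_top_iff]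
  rintro ⟨x, hx⟩ -
  obtain ⟨y, hy, hxy⟩ := h x hx.1 (by rw [LinearMap.mem_ker.1 hx.2]; exact zero_mem _)
  rw [chains_bot, Submodule.mem_bot, sub_eq_zero] at hxy
  exact ⟨y, hy, hxy.symm⟩

theorem nonempty_reducedHomology_equiv (h : OneDimAt K Δ ⊥ m) :
    Nonempty (ReducedHomology K Δ m ≃ₗ[K] K) := by
  obtain ⟨z, hz, hdz, hne, hgen⟩ := h
  simp only [chains_bot, Submodule.mem_bot] at hdz hne hgen
  let z' : cycles K Δ m := ⟨z, hz, hdz⟩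
  let g : K →ₗ[K] ReducedHomology K Δ m :=
    LinearMap.toSpanSingleton K _ (Submodule.Quotient.mk z')
  refine ⟨(LinearEquiv.ofBijective g ⟨?_, ?_⟩).symm⟩
  · rw [← LinearMap.ker_eq_bot, LinearMap.ker_eq_bot']
    intro c hc
    by_contra hc0
    rw [LinearMap.toSpanSingleton_apply, smul_eq_zero_iff_right hc0,
      Submodule.Quotient.mk_eq_zero] at hc
    obtain ⟨y, hy, hyz⟩ := hc
    exact hne y hy (sub_eq_zero.2 hyz.symm)
  · intro w
    obtain ⟨⟨x, hx⟩, rfl⟩ := Submodule.Quotient.mk_surjective _ w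
    obtain ⟨c, y, hy, hxy⟩ := hgen x hx.1 hx.2
    refine ⟨c, ?_⟩
    rw [LinearMap.toSpanSingleton_apply, ← Submodule.Quotient.mk_smul, eq_comm,
      Submodule.Quotient.eq]
    exact ⟨y, hy, (sub_eq_zero.1 hxy).symm⟩

end Absolute

end RelativeHomology

/-! ### Hitting sets of a single run. -/

section HittingSets

variable {V : Type*}

/-- The set `G` meets each of the `s` consecutive blocks `x k, …, x (k + t - 1)` that start with
`x a`. -/
def Hits (t : ℕ) (x : ℕ → V) (a s : ℕ) (G : Finset V) : Prop :=
  ∀ k < s, ∃ j < t, x (a + k + j) ∈ G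

/-- If the vertex after the first block belongs to `G`, only the first block and the blocks beyond
that vertex have to be met. -/
theorem hits_iff_of_mem {t : ℕ} {x : ℕ → V} {a s : ℕ} (hs : 1 ≤ s) {G : Finset V}
    (hG : x (a + t) ∈ G) :
    Hits t x a s G ↔ (∃ j < t, x (a + j) ∈ G) ∧ Hits t x (a + t + 1) (s - (t + 1)) G := by
  constructor
  · intro h
    refine ⟨by simpa using h 0 hs, fun k hk => ?_⟩
    obtain ⟨j, hj, hx⟩ := h (t + 1 + k) (by omega)
    exact ⟨j, hj, by convert hx using 2; ring⟩
  · rintro ⟨⟨j, hj, hx⟩, h⟩ k hk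
    rcases Nat.eq_zero_or_pos k with rfl | hk0
    · exact ⟨j, hj, hx⟩
    rcases Nat.lt_or_ge t k with hkt | hkt
    · obtain ⟨j, hj, hx⟩ := h (k - (t + 1)) (by omega)
      exact ⟨j, hj, by convert hx using 2; omega⟩
    -- For `1 ≤ k ≤ t` the `k`-th block contains `x (a + t)` at offset `t - k`.
    · exact ⟨t - k, by omega, by convert hG using 2; omega⟩

variable [LinearOrder V]

/-- Membership in the family `T` does not depend on the vertex `v`. -/
def IndepOf (T : Set (Finset V)) (v : V) : Prop :=
  ∀ G, insert v G ∈ T ↔ G ∈ T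

theorem IndepOf.erase_mem {T : Set (Finset V)} {v : V} (h : IndepOf T v) {G : Finset V}
    (hG : G ∈ T) : G.erase v ∈ T := by
  rw [← h]
  by_cases hv : v ∈ G
  · rwa [Finset.insert_erase hv]
  · rwa [Finset.erase_eq_of_notMem hv, h]

theorem IndepOf.trace {ι : Type*} {T : Set (Finset V)} {v : V} (h : IndepOf T v) {I : Set ι}
    {x : ι → V} {p : ι → Prop} (hx : ∀ k ∈ I, x k ≠ v) :
    IndepOf {G | G ∈ T ∧ ∀ k ∈ I, x k ∈ G ↔ p k} v := by
  intro G
  simp only [Set.mem_ofPred_eq]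
  rw [h]
  refine and_congr_right fun _ => forall₂_congr fun k hk => ?_
  rw [Finset.mem_insert, or_iff_right (hx k hk)]

theorem hits_insert {t : ℕ} {x : ℕ → V} {a s : ℕ} {v : V}
    (hv : ∀ k ∈ Set.Ico a (a + s + t - 1), x k ≠ v) (G : Finset V) :
    Hits t x a s (insert v G) ↔ Hits t x a s G := by
  refine forall₂_congr fun k hk => exists_congr fun j => and_congr_right fun hj => ?_
  rw [Finset.mem_insert, or_iff_right (hv _ ⟨by omega, by omega⟩)]

variable (K : Type*) [Field K]

theorem reducesTo_empty {S : Set (Finset V)} {v : V} (h : IndepOf S v) : ReducesTo K S ∅ :=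
  reducesTo_of_lower (Set.empty_subset _) (fun _ hF => hF.elim) v
    (fun F hF _ => ⟨(h F).2 hF, fun h => h.elim⟩) (fun _ hF _ => ⟨h.erase_mem hF, fun h => h.elim⟩)

/-- If a vertex of the block other than the last is present, the block is hit anyway and the last
vertex can be toggled. The sets left over have the last vertex as their whole trace, and they form a
lower part. -/
theorem reducesTo_last_of_block {t : ℕ} (ht : 1 ≤ t) {x : ℕ → V} {a : ℕ}
    (hx : Set.InjOn x (Set.Ico a (a + t))) {T : Set (Finset V)}
    (hT : IndepOf T (x (a + t - 1))) :
    ReducesTo K {G | G ∈ T ∧ ∃ j < t, x (a + j) ∈ G}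
      {G | G ∈ T ∧ ∀ j < t, x (a + j) ∈ G ↔ j + 1 = t} := by
  set S : Set (Finset V) := {G | G ∈ T ∧ ∃ j < t, x (a + j) ∈ G} with hS
  set A : Set (Finset V) := {G | G ∈ T ∧ ∀ j < t, x (a + j) ∈ G ↔ j + 1 = t} with hA
  have hlast : x (a + (t - 1)) = x (a + t - 1) := by rw [Nat.add_sub_assoc ht]
  have hdiff : ∀ G, G ∈ S \ A ↔ G ∈ T ∧ ∃ j, j + 1 < t ∧ x (a + j) ∈ G := by
    intro G
    constructor
    · rintro ⟨⟨hGT, j, hj, hxj⟩, hGA⟩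
      refine ⟨hGT, by_contra fun hne => hGA ⟨hGT, fun i hi => ?_⟩⟩
      push Not at hne
      have : ∀ i < t, x (a + i) ∈ G → i + 1 = t := fun i hi h =>
        by_contra fun hit => hne i (by omega) h
      refine ⟨this i hi, fun hit => ?_⟩
      have := this j hj hxj
      rwa [show i = j by omega]
    · rintro ⟨hGT, j, hj, hxj⟩
      exact ⟨⟨hGT, j, by omega, hxj⟩, fun hGA => by have := (hGA.2 j (by omega)).1 hxj; omega⟩
  have hind : IndepOf (S \ A) (x (a + t - 1)) := by
    intro G
    rw [hdiff, hdiff, hT]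
    refine and_congr_right fun _ => exists_congr fun j => and_congr_right fun hj => ?_
    rw [Finset.mem_insert, or_iff_right]
    intro h
    have := hx ⟨by omega, by omega⟩ ⟨by omega, by omega⟩ h
    omega
  refine reducesTo_of_lower ?_ ?_ (x (a + t - 1)) (fun F hF hA => (hind F).2 ⟨hF, hA⟩)
    (fun F hF hA => hind.erase_mem ⟨hF, hA⟩)
  · rintro G ⟨hGT, hG⟩
    exact ⟨hGT, t - 1, by omega, (hG _ (by omega)).2 (by omega)⟩
  · rintro F ⟨_, hF⟩ G ⟨hGT, j, hj, hxj⟩ hGF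
    refine ⟨hGT, fun i hi => ⟨fun h => (hF i hi).1 (hGF h), fun h => ?_⟩⟩
    have := (hF j hj).1 (hGF hxj)
    rwa [show i = j by omega]

/-- If `x (a + t)` is missing, whatever hits the second block lies in its overlap with the first, so
the first condition is redundant and `x a` can be toggled. Containing `x (a + t)` is an upward
closed condition. -/
theorem reducesTo_mem_of_hits {t : ℕ} {x : ℕ → V} {a s : ℕ} (hs : 2 ≤ s)
    (hx : Set.InjOn x (Set.Ico a (a + s + t - 1))) {T : Set (Finset V)} (hT : IndepOf T (x a)) :
    ReducesTo K {G | G ∈ T ∧ Hits t x a s G} {G | (G ∈ T ∧ Hits t x a s G) ∧ x (a + t) ∈ G} := by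
  set S : Set (Finset V) := {G | G ∈ T ∧ Hits t x a s G} with hS
  have hne : ∀ k, a < k → k < a + s + t - 1 → x k ≠ x a := fun k h1 h2 h => by
    have := hx ⟨by omega, by omega⟩ ⟨by omega, by omega⟩ h
    omega
  have hind : IndepOf (S \ {G | G ∈ S ∧ x (a + t) ∈ G}) (x a) := by
    have hdiff : ∀ G, G ∈ S \ {G | G ∈ S ∧ x (a + t) ∈ G} ↔
        G ∈ T ∧ Hits t x (a + 1) (s - 1) G ∧ x (a + t) ∉ G := by
      intro G
      constructor
      · rintro ⟨hG, hGA⟩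
        refine ⟨hG.1, fun k hk => ?_, fun h => hGA ⟨hG, h⟩⟩
        obtain ⟨j, hj, hxj⟩ := hG.2 (1 + k) (by omega)
        exact ⟨j, hj, by convert hxj using 2; ring⟩
      · rintro ⟨hGT, hG, hGA⟩
        refine ⟨⟨hGT, fun k hk => ?_⟩, fun h => hGA h.2⟩
        rcases Nat.eq_zero_or_pos k with rfl | hk0
        · obtain ⟨j, hj, hxj⟩ := hG 0 (by omega)
          have hjt : j + 1 ≠ t := fun h => hGA (by convert hxj using 2; omega)
          exact ⟨j + 1, by omega, by convert hxj using 2; ring⟩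
        · obtain ⟨j, hj, hxj⟩ := hG (k - 1) (by omega)
          exact ⟨j, hj, by convert hxj using 2; omega⟩
    intro G
    -- For `t = 0` the vertices `x a` and `x (a + t)` coincide, but empty blocks are never hit.
    rcases Nat.eq_zero_or_pos t with rfl | ht
    · rw [hdiff, hdiff]
      have : ∀ G, ¬ Hits 0 x (a + 1) (s - 1) G := fun G h => by
        obtain ⟨j, hj, -⟩ := h 0 (by omega)
        omega
      simp [this]
    rw [hdiff, hdiff, hT, hits_insert fun k hk => hne k (by have := hk.1; omega)
      (by have := hk.2; omega), Finset.mem_insert, or_iff_right (hne _ (by omega) (by omega))]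
  refine reducesTo_of_upper (fun G hG => hG.1) ?_ (x a) (fun F hF hA => (hind F).2 ⟨hF, hA⟩)
    (fun F hF hA => hind.erase_mem ⟨hF, hA⟩)
  rintro F ⟨_, hF⟩ G hG hFG
  exact ⟨hG, hFG hF⟩

/-- A run of length at least two is cut behind its first `t + 1` vertices, of which precisely the
last two are kept. -/
theorem reducesTo_hits_tail {t : ℕ} (ht : 2 ≤ t) {x : ℕ → V} {a s : ℕ} (hs : 2 ≤ s)
    (hx : Set.InjOn x (Set.Ico a (a + s + t - 1))) {T : Set (Finset V)}
    (hT : ∀ k ∈ Set.Ico a (a + s + t - 1), IndepOf T (x k)) :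
    ReducesTo K {G | G ∈ T ∧ Hits t x a s G}
      {G | (G ∈ T ∧ ∀ k ∈ Set.Ico a (a + t + 1), x k ∈ G ↔ k = a + t - 1 ∨ k = a + t) ∧
        Hits t x (a + t + 1) (s - (t + 1)) G} := by
  refine (reducesTo_mem_of_hits K hs hx (hT a ⟨le_rfl, by omega⟩)).trans ?_
  have hne : ∀ k ∈ Set.Ico a (a + s + t - 1), k ≠ a + t - 1 → x k ≠ x (a + t - 1) :=
    fun k hk h h' => h (hx hk ⟨by omega, by omega⟩ h')
  have hind : IndepOf {G | (G ∈ T ∧ x (a + t) ∈ G) ∧ Hits t x (a + t + 1) (s - (t + 1)) G}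
      (x (a + t - 1)) := by
    intro G
    simp only [Set.mem_ofPred_eq]
    rw [hT _ ⟨by omega, by omega⟩, Finset.mem_insert,
      or_iff_right (hne _ ⟨by omega, by omega⟩ (by omega))]
    refine and_congr_right fun _ => ?_
    -- For `s ≤ t + 1` the truncated difference is zero and nothing remains to be hit behind `x (a +
    -- t)`.
    rcases Nat.eq_zero_or_pos (s - (t + 1)) with h0 | h0
    · simp [h0, Hits]
    · exact hits_insert (fun k hk => hne k ⟨by have := hk.1; omega, by have := hk.2; omega⟩
        (by have := hk.1; omega)) G
  convert reducesTo_last_of_block K (by omega) (hx.mono (Set.Ico_subset_Ico_right (by omega))) hind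
    using 1
  · ext G
    simp only [Set.mem_ofPred_eq]
    constructor
    · rintro ⟨⟨hGT, hG⟩, hm⟩
      rw [hits_iff_of_mem (by omega) hm] at hG
      exact ⟨⟨⟨hGT, hm⟩, hG.2⟩, hG.1⟩
    · rintro ⟨⟨⟨hGT, hm⟩, hG2⟩, hG1⟩
      exact ⟨⟨hGT, (hits_iff_of_mem (by omega) hm).2 ⟨hG1, hG2⟩⟩, hm⟩
  · ext G
    simp only [Set.mem_ofPred_eq]
    constructor
    · rintro ⟨⟨hGT, hG⟩, hh⟩
      refine ⟨⟨⟨hGT, (hG _ ⟨by omega, by omega⟩).2 (Or.inr rfl)⟩, hh⟩, fun j hj => ?_⟩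
      rw [hG _ ⟨by omega, by omega⟩]
      omega
    · rintro ⟨⟨⟨hGT, hm⟩, hh⟩, hG⟩
      refine ⟨⟨hGT, fun k hk => ?_⟩, hh⟩
      obtain ⟨h1, h2⟩ := hk
      rcases eq_or_ne k (a + t) with rfl | hk
      · exact iff_of_true hm (Or.inr rfl)
      · have := hG (k - a) (by omega)
        rw [show a + (k - a) = k by omega] at this
        rw [this]
        omega

/-- A run whose length is congruent to `1` or `2` modulo `t + 1` reduces to a single trace. -/
theorem exists_reducesTo_trace {t : ℕ} (ht : 2 ≤ t) (s : ℕ) :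
    ∀ a, (s % (t + 1) = 1 ∨ s % (t + 1) = 2) →
    ∃ R : Finset ℕ, R ⊆ Finset.Ico a (a + s + t - 1) ∧
      R.card = 2 * (s / (t + 1)) + s % (t + 1) ∧
      ∀ x : ℕ → V, Set.InjOn x (Set.Ico a (a + s + t - 1)) → ∀ T : Set (Finset V),
        (∀ k ∈ Set.Ico a (a + s + t - 1), IndepOf T (x k)) →
        ReducesTo K {G | G ∈ T ∧ Hits t x a s G}
          {G | G ∈ T ∧ ∀ k ∈ Set.Ico a (a + s + t - 1), x k ∈ G ↔ k ∈ R} := by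
  induction s using Nat.strong_induction_on with
  | _ s ih =>
  intro a hs
  rcases Nat.lt_or_ge s (t + 1) with hst | hst
  · rw [Nat.mod_eq_of_lt hst] at hs ⊢
    rw [Nat.div_eq_of_lt hst]
    rcases hs with rfl | rfl
    · refine ⟨{a + t - 1}, ?_, by simp, fun x hx T hT => ?_⟩
      · simp only [Finset.singleton_subset_iff, Finset.mem_Ico]
        omega
      rw [show a + 1 + t - 1 = a + t by omega] at hx hT ⊢
      convert reducesTo_last_of_block K (by omega) hx (hT (a + t - 1) ⟨by omega, by omega⟩) using 1
      · simp [Hits]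
      · ext G
        refine and_congr_right fun _ => ⟨fun h j hj => ?_, fun h k hk => ?_⟩
        · rw [h _ ⟨by omega, by omega⟩, Finset.mem_singleton]
          omega
        · obtain ⟨h1, h2⟩ := hk
          have := h (k - a) (by omega)
          rw [show a + (k - a) = k by omega] at this
          rw [this, Finset.mem_singleton]
          omega
    · refine ⟨{a + t - 1, a + t}, ?_, ?_, fun x hx T hT => ?_⟩
      · simp only [Finset.insert_subset_iff, Finset.singleton_subset_iff, Finset.mem_Ico]
        omega
      · rw [Finset.card_pair (by omega)]
      convert reducesTo_hits_tail K ht le_rfl hx hT using 1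
      ext G
      simp [Hits, show 2 - (t + 1) = 0 by omega, show a + 2 + t - 1 = a + t + 1 by omega]
  · have hlen : a + t + 1 + (s - (t + 1)) + t - 1 = a + s + t - 1 := by omega
    have hmod := Nat.mod_eq_sub_mod hst
    have hdiv := Nat.div_eq_sub_div (by omega) hst
    rw [hmod] at hs
    have hpos : s - (t + 1) ≠ 0 := fun h => by simp [h] at hs
    obtain ⟨R, hR, hcard, hred⟩ := ih (s - (t + 1)) (by omega) (a + t + 1) hs
    rw [hlen] at hR hred
    have hR' : ∀ k ∈ R, a + t + 1 ≤ k := fun k hk => (Finset.mem_Ico.1 (hR hk)).1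
    have h1 : a + t ∉ R := fun h => by have := hR' _ h; omega
    have h2 : a + t - 1 ∉ insert (a + t) R := fun h => by
      rcases Finset.mem_insert.1 h with h | h
      · omega
      · have := hR' _ h
        omega
    -- The two vertices kept at this cut, together with those kept in the shorter run.
    refine ⟨insert (a + t - 1) (insert (a + t) R), ?_, ?_, fun x hx T hT => ?_⟩
    · simp only [Finset.insert_subset_iff, Finset.mem_Ico]
      exact ⟨by omega, by omega, hR.trans (Finset.Ico_subset_Ico (by omega) le_rfl)⟩
    · rw [Finset.card_insert_of_notMem h2, Finset.card_insert_of_notMem h1, hcard, hmod, hdiv]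
      ring
    have hne : ∀ i ∈ Set.Ico a (a + t + 1), ∀ k ∈ Set.Ico (a + t + 1) (a + s + t - 1),
        x i ≠ x k := fun i ⟨h1, h2⟩ k ⟨h3, h4⟩ h => by
      have := hx ⟨h1, by omega⟩ ⟨by omega, h4⟩ h
      omega
    refine (reducesTo_hits_tail K ht (by omega) hx hT).trans ?_
    convert hred x (hx.mono (Set.Ico_subset_Ico (by omega) le_rfl))
      {G | G ∈ T ∧ ∀ k ∈ Set.Ico a (a + t + 1), x k ∈ G ↔ k = a + t - 1 ∨ k = a + t} ?_ using 1
    · rfl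
    · ext G
      simp only [Set.mem_ofPred_eq, Finset.mem_insert]
      constructor
      · rintro ⟨hGT, hG⟩
        refine ⟨⟨hGT, fun k hk => ?_⟩, fun k hk => ?_⟩
        · obtain ⟨h3, h4⟩ := hk
          have : k ∉ R := fun h => by have := hR' k h; omega
          rw [hG k ⟨h3, by omega⟩]
          tauto
        · obtain ⟨h3, h4⟩ := hk
          rw [hG k ⟨by omega, h4⟩]
          have : k ≠ a + t - 1 := by omega
          have : k ≠ a + t := by omega
          tauto
      · rintro ⟨⟨hGT, hG1⟩, hG2⟩
        refine ⟨hGT, fun k hk => ?_⟩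
        obtain ⟨h3, h4⟩ := hk
        rcases Nat.lt_or_ge k (a + t + 1) with h5 | h5
        · rw [hG1 k ⟨h3, h5⟩]
          have : k ∉ R := fun h => by have := hR' k h; omega
          tauto
        · rw [hG2 k ⟨h5, h4⟩]
          have : k ≠ a + t - 1 := by omega
          have : k ≠ a + t := by omega
          tauto
    · exact fun k hk => (hT k ⟨by have := hk.1; omega, hk.2⟩).trace fun i hi => hne i hi k hk

/-- Cutting off `t + 1` at a time reaches a length from `3` to `t + 1`. One more cut then leaves a
vertex subject to no condition, and toggling it cancels the whole family. -/
theorem reducesTo_empty_of_mod {t : ℕ} (ht : 2 ≤ t) (s : ℕ) (hs : 1 ≤ s)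
    (hs1 : s % (t + 1) ≠ 1) (hs2 : s % (t + 1) ≠ 2) :
    ∀ (a : ℕ) (x : ℕ → V), Set.InjOn x (Set.Ico a (a + s + t - 1)) → ∀ T : Set (Finset V),
      (∀ k ∈ Set.Ico a (a + s + t - 1), IndepOf T (x k)) →
      ReducesTo K {G | G ∈ T ∧ Hits t x a s G} ∅ := by
  induction s using Nat.strong_induction_on with
  | _ s ih =>
  intro a x hx T hT
  have hs3 : 3 ≤ s := by
    by_contra h
    obtain rfl | rfl : s = 1 ∨ s = 2 := by omega
    · exact hs1 (Nat.mod_eq_of_lt (by omega))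
    · exact hs2 (Nat.mod_eq_of_lt (by omega))
  refine (reducesTo_hits_tail K ht (by omega) hx hT).trans ?_
  have hind : ∀ k ∈ Set.Ico (a + t + 1) (a + s + t - 1), IndepOf
      {G | G ∈ T ∧ ∀ k ∈ Set.Ico a (a + t + 1), x k ∈ G ↔ k = a + t - 1 ∨ k = a + t} (x k) := by
    refine fun k hk => (hT k ⟨by have := hk.1; omega, hk.2⟩).trace fun i hi h => ?_
    obtain ⟨h1, h2⟩ := hi
    obtain ⟨h3, h4⟩ := hk
    have := hx ⟨h1, by omega⟩ ⟨by omega, h4⟩ h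
    omega
  rcases Nat.lt_or_ge (t + 1) s with hst | hst
  · have hlen : a + t + 1 + (s - (t + 1)) + t - 1 = a + s + t - 1 := by omega
    rw [Nat.mod_eq_sub_mod hst.le] at hs1 hs2
    refine ih (s - (t + 1)) (by omega) (by omega) hs1 hs2 (a + t + 1) x ?_ _ ?_
    · rw [hlen]
      exact hx.mono (Set.Ico_subset_Ico (by omega) le_rfl)
    · rwa [hlen]
  -- The vertex `x (a + t + 1)` belongs to the run because `s ≥ 3`, and it is free because `s ≤ t +
  -- 1`.
  · have h := hind (a + t + 1) ⟨le_rfl, by omega⟩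
    rw [Nat.sub_eq_zero_of_le hst]
    refine reducesTo_empty K (v := x (a + t + 1)) ?_
    simpa [Hits] using h

end HittingSets

/-! ### Treating the runs one at a time. -/

section SeveralRuns

variable {V : Type*} [LinearOrder V] (K : Type*) [Field K]

theorem IndepOf.and_forall_hits {ι : Type*} {T : Set (Finset V)} {v : V} (h : IndepOf T v)
    {P : ι → Prop} {t : ℕ} {s : ι → ℕ} {x : ι → ℕ → V}
    (hx : ∀ j, P j → ∀ k ∈ Set.Ico 0 (0 + s j + t - 1), x j k ≠ v) :
    IndepOf {G | G ∈ T ∧ ∀ j, P j → Hits t (x j) 0 (s j) G} v := by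
  intro G
  simp only [Set.mem_ofPred_eq]
  rw [h]
  exact and_congr_right fun _ => forall₂_congr fun j hj => hits_insert (hx j hj) G

variable {ι : Type*} {t : ℕ} {s : ι → ℕ} {x : ι → ℕ → V}

/-- The runs are disjoint, so the conditions on the others, already reduced (`J`) or not, can be put
into the background family `T` while one run is reduced. -/
theorem exists_reducesTo_traces (ht : 2 ≤ t)
    (hs : ∀ j, s j % (t + 1) = 1 ∨ s j % (t + 1) = 2)
    (hx : ∀ j, ∀ k < s j + t - 1, ∀ j', ∀ k' < s j' + t - 1, x j k = x j' k' → j = j' ∧ k = k')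
    {T : Set (Finset V)} (hT : ∀ j, ∀ k < s j + t - 1, IndepOf T (x j k)) :
    ∃ R : ι → Finset ℕ, (∀ j, R j ⊆ Finset.range (s j + t - 1) ∧
        (R j).card = 2 * (s j / (t + 1)) + s j % (t + 1)) ∧
      ∀ J : Finset ι, ReducesTo K {G | G ∈ T ∧ ∀ j, Hits t (x j) 0 (s j) G}
        {G | G ∈ T ∧ (∀ j ∈ J, ∀ k < s j + t - 1, x j k ∈ G ↔ k ∈ R j) ∧
          ∀ j ∉ J, Hits t (x j) 0 (s j) G} := by
  classical
  choose R hR hcard hred using fun j => exists_reducesTo_trace (V := V) K ht (s j) 0 (hs j)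
  simp only [zero_add, Set.mem_Ico, zero_le, true_and] at hR hred
  refine ⟨R, fun j => ⟨fun k hk => by simpa using hR j hk, hcard j⟩, fun J => ?_⟩
  induction J using Finset.induction_on with
  | empty => simpa using ReducesTo.refl {G | G ∈ T ∧ ∀ j, Hits t (x j) 0 (s j) G}
  | insert i J hi ih =>
    refine ih.trans ?_
    have hne : ∀ j, j ≠ i → ∀ k < s j + t - 1, ∀ k' < s i + t - 1, x j k ≠ x i k' :=
      fun j hj k hk k' hk' h => hj (hx j k hk i k' hk' h).1
    have hind : ∀ k < s i + t - 1, IndepOf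
        {G | G ∈ {G | G ∈ T ∧ ∀ p ∈ {p : ι × ℕ | p.1 ∈ J ∧ p.2 < s p.1 + t - 1},
          x p.1 p.2 ∈ G ↔ p.2 ∈ R p.1} ∧ ∀ j, j ∉ insert i J → Hits t (x j) 0 (s j) G} (x i k) := by
      intro k hk
      refine ((hT i k hk).trace fun p hp => ?_).and_forall_hits fun j hj k' hk' => ?_
      · exact hne _ (fun h => hi (h ▸ hp.1)) _ hp.2 _ hk
      · exact hne _ (fun h => hj (h ▸ Finset.mem_insert_self _ _)) _ (by simpa using hk'.2) _ hk
    convert hred i (x i) (fun k hk k' hk' h => (hx i k hk.2 i k' hk'.2 h).2) _ hind using 1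
    · ext G
      simp only [Set.mem_ofPred_eq, Prod.forall, Finset.mem_insert, not_or]
      constructor
      · rintro ⟨h1, h2, h3⟩
        exact ⟨⟨⟨h1, fun j k hjk => h2 j hjk.1 k hjk.2⟩, fun j hj => h3 j hj.2⟩, h3 i hi⟩
      · rintro ⟨⟨⟨h1, h2⟩, h3⟩, h4⟩
        refine ⟨h1, fun j hj k hk => h2 j k ⟨hj, hk⟩, fun j hj => ?_⟩
        rcases eq_or_ne j i with rfl | hji
        exacts [h4, h3 j ⟨hji, hj⟩]
    · ext G
      simp only [Set.mem_ofPred_eq, Prod.forall, Finset.mem_insert, not_or]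
      constructor
      · rintro ⟨h1, h2, h3⟩
        exact ⟨⟨⟨h1, fun j k hjk => h2 j (Or.inr hjk.1) k hjk.2⟩, h3⟩, h2 i (Or.inl rfl)⟩
      · rintro ⟨⟨⟨h1, h2⟩, h3⟩, h4⟩
        refine ⟨h1, ?_, h3⟩
        rintro j (rfl | hj) k hk
        exacts [h4 k hk, h2 j k ⟨hj, hk⟩]

theorem reducesTo_empty_of_exists_mod (ht : 2 ≤ t) {i : ι} (hs : 1 ≤ s i)
    (hs1 : s i % (t + 1) ≠ 1) (hs2 : s i % (t + 1) ≠ 2)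
    (hx : ∀ j, ∀ k < s j + t - 1, ∀ j', ∀ k' < s j' + t - 1, x j k = x j' k' → j = j' ∧ k = k')
    {T : Set (Finset V)} (hT : ∀ j, ∀ k < s j + t - 1, IndepOf T (x j k)) :
    ReducesTo K {G | G ∈ T ∧ ∀ j, Hits t (x j) 0 (s j) G} ∅ := by
  convert reducesTo_empty_of_mod K ht (s i) hs hs1 hs2 0 (x i) ?_
    {G | G ∈ T ∧ ∀ j, j ≠ i → Hits t (x j) 0 (s j) G} ?_ using 1
  · ext G
    simp only [Set.mem_ofPred_eq]
    constructor
    · exact fun ⟨h1, h2⟩ => ⟨⟨h1, fun j _ => h2 j⟩, h2 i⟩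
    · rintro ⟨⟨h1, h2⟩, h3⟩
      refine ⟨h1, fun j => ?_⟩
      rcases eq_or_ne j i with rfl | hji
      exacts [h3, h2 j hji]
  · exact fun k hk k' hk' h => (hx i k (by simpa using hk.2) i k' (by simpa using hk'.2) h).2
  · intro k hk
    have hk' : k < s i + t - 1 := by simpa using hk.2
    exact (hT i k hk').and_forall_hits fun j hj l hl h =>
      hj (hx j l (by simpa using hl.2) i k hk' h).1

end SeveralRuns

/-! ### Path complexes of line graphs as complexes of intervals. -/

section Runs

/-- By induction, a path's tail covers an interval starting at a neighbour of the new vertex; as the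
new vertex is not in it, it extends the interval by one. -/
theorem toFinset_support_of_isPath {n : ℕ} {u v : Fin n}
    (w : (SimpleGraph.pathGraph n).Walk u v) (hw : w.IsPath) :
    w.support.toFinset = Finset.uIcc u v := by
  induction w with
  | nil => simp
  | @cons u u' v h p ih =>
    rw [SimpleGraph.Walk.cons_isPath_iff] at hw
    have ih := ih hw.1
    have hu : u ∉ Finset.uIcc u' v := by
      rw [← ih, List.mem_toFinset]
      exact hw.2
    rw [SimpleGraph.Walk.support_cons, List.toFinset_cons, ih]
    rw [SimpleGraph.pathGraph_adj] at h
    ext i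
    simp only [Finset.mem_insert, Finset.mem_uIcc', Fin.ext_iff, Fin.le_def] at hu ⊢
    omega

/-- The `t` consecutive vertices beginning with the `k`-th one. -/
def block (t n k : ℕ) : Finset (Fin n) := Finset.univ.filter fun i => k ≤ i ∧ (i : ℕ) < k + t

theorem card_block {t n k : ℕ} (h : k + t ≤ n) : (block t n k).card = t := by
  have : (block t n k).map Fin.valEmbedding = Finset.Ico k (k + t) := by
    ext i
    simp only [block, Finset.mem_map, Finset.mem_filter, Finset.mem_univ, true_and,
      Fin.valEmbedding_apply, Finset.mem_Ico]
    exact ⟨fun ⟨j, hj, hji⟩ => hji ▸ hj, fun hi => ⟨⟨i, by omega⟩, hi, rfl⟩⟩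
  rw [← Finset.card_map Fin.valEmbedding, this]
  simp

theorem card_support_of_isPath {W : Type*} [DecidableEq W] {G : SimpleGraph W} {u v : W}
    {w : G.Walk u v} (hw : w.IsPath) : w.support.toFinset.card = w.length + 1 := by
  rw [List.toFinset_card_of_nodup hw.support_nodup, SimpleGraph.Walk.length_support]

theorem exists_isPath_pathGraph_iff {t n : ℕ} (ht : 1 ≤ t) (F : Finset (Fin n)) :
    (∃ (u v : Fin n) (w : (SimpleGraph.pathGraph n).Walk u v),
      w.IsPath ∧ w.length + 1 = t ∧ F = w.support.toFinset) ↔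
    ∃ k, k + t ≤ n ∧ F = block t n k := by
  constructor
  · rintro ⟨u, v, w, hw, hlen, rfl⟩
    have hcard := card_support_of_isPath hw
    rw [hlen, toFinset_support_of_isPath w hw, Fin.card_uIcc] at hcard
    refine ⟨min (u : ℕ) v, by omega, ?_⟩
    rw [toFinset_support_of_isPath w hw]
    ext i
    simp only [Finset.mem_uIcc', Fin.le_def, block, Finset.mem_filter,
      Finset.mem_univ, true_and]
    omega
  · rintro ⟨k, hk, rfl⟩
    obtain ⟨w, hw⟩ := (SimpleGraph.pathGraph_preconnected n).exists_isPath
      (⟨k, by omega⟩ : Fin n) ⟨k + t - 1, by omega⟩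
    have hF : block t n k = w.support.toFinset := by
      rw [toFinset_support_of_isPath w hw]
      ext i
      simp only [Finset.mem_uIcc', Fin.le_def, block, Finset.mem_filter,
        Finset.mem_univ, true_and]
      omega
    exact ⟨_, _, w, hw, by rw [← card_support_of_isPath hw, ← hF, card_block hk], hF⟩

theorem mem_run_iff {t s : ℕ} (ht : 1 ≤ t) (F : Finset (Fin (s + t - 1))) :
    F ∈ run t s ↔ ∃ k < s, F ⊆ block t (s + t - 1) k := by
  rw [run, pathComplex, mem_lowerClosure]
  simp only [Set.mem_ofPred_eq, exists_isPath_pathGraph_iff ht]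
  constructor
  · rintro ⟨_, ⟨k, hk, rfl⟩, hF⟩
    exact ⟨k, by omega, hF⟩
  · rintro ⟨k, hk, hF⟩
    exact ⟨_, ⟨k, by omega, rfl⟩, hF⟩

theorem IsDisjointUnionOfRuns.exists_vertices {ι V : Type*} [DecidableEq V] {t : ℕ} (ht : 2 ≤ t)
    {s : ι → ℕ} {Γ : FaceComplex V} (h : Γ.IsDisjointUnionOfRuns t s) :
    ∃ x : ι → ℕ → V,
      (∀ j, ∀ k < s j + t - 1, ∀ j', ∀ k' < s j' + t - 1, x j k = x j' k' → j = j' ∧ k = k') ∧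
      ∀ F, F ∈ Γ ↔ ∃ j, ∃ k < s j, F ⊆ (Finset.Ico k (k + t)).image (x j) := by
  obtain ⟨f, rfl⟩ := h
  -- Indices past the end are sent to the last vertex, merely to make `x j` total.
  let x : ι → ℕ → V := fun j k => f ⟨j, ⟨min k (s j + t - 2), by omega⟩⟩
  have hxf : ∀ j (i : Fin (s j + t - 1)), x j i = f ⟨j, i⟩ := by
    intro j i
    simp only [x]
    congr 2
    ext
    simp only
    omega
  have hB : ∀ j, ∀ k < s j,
      ((block t (s j + t - 1) k).map (Function.Embedding.sigmaMk j)).map f =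
        (Finset.Ico k (k + t)).image (x j) := by
    intro j k hk
    ext v
    simp only [Finset.mem_map, exists_exists_and_eq_and, Function.Embedding.sigmaMk_apply,
      block, Finset.mem_filter, Finset.mem_univ, true_and, Finset.mem_image, Finset.mem_Ico]
    constructor
    · rintro ⟨i, hi, rfl⟩
      exact ⟨i, hi, hxf j i⟩
    · rintro ⟨i, hi, rfl⟩
      exact ⟨⟨i, by omega⟩, hi, (hxf j ⟨i, by omega⟩).symm⟩
  refine ⟨x, ?_, fun F => ?_⟩
  · intro j k hk j' k' hk' h
    have h1 := hxf j ⟨k, hk⟩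
    have h2 := hxf j' ⟨k', hk'⟩
    simp only at h1 h2
    rw [h1, h2, f.injective.eq_iff, Sigma.mk.injEq] at h
    obtain ⟨rfl, h⟩ := h
    exact ⟨rfl, congrArg Fin.val (eq_of_heq h)⟩
  · rw [map, mem_lowerClosure]
    constructor
    · rintro ⟨_, ⟨G, hG, rfl⟩, hF⟩
      rw [disjointUnion, mem_lowerClosure] at hG
      obtain ⟨_, ⟨j, H, hH, rfl⟩, hG⟩ := hG
      obtain ⟨k, hk, hH⟩ := (mem_run_iff (by omega) H).1 hH
      refine ⟨j, k, hk, ?_⟩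
      rw [← hB j k hk]
      exact hF.trans (Finset.map_subset_map.2 (hG.trans (Finset.map_subset_map.2 hH)))
    · rintro ⟨j, k, hk, hF⟩
      rw [← hB j k hk] at hF
      exact ⟨_, ⟨_, subset_lowerClosure ⟨j, _, (mem_run_iff (by omega) _).2 ⟨k, hk, subset_rfl⟩,
        rfl⟩, rfl⟩, hF⟩

end Runs

/-! ### The complement complex and its non-faces. -/

section Complement

/-- The complex of all finite sets of vertices of `Δ`. -/
def vertexSimplex {V : Type*} (Δ : FaceComplex V) : FaceComplex V where
  carrier := {G | (G : Set V) ⊆ Δ.vertexSet}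
  lower' := fun _ _ hHG hG => subset_trans (Finset.coe_subset.mpr hHG) hG

theorem mem_vertexSimplex {V : Type*} {Δ : FaceComplex V} {G : Finset V} :
    G ∈ Δ.vertexSimplex ↔ (G : Set V) ⊆ Δ.vertexSet := Iff.rfl

theorem complement_le_vertexSimplex {V : Type*} (Δ : FaceComplex V) :
    Δ.complement ≤ Δ.vertexSimplex :=
  fun _ ⟨_, _, hG⟩ => hG.trans Set.sdiff_subset

variable {ι V : Type*} [LinearOrder V] {t : ℕ} {s : ι → ℕ} {x : ι → ℕ → V} {Γ : FaceComplex V}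

/-- All blocks have exactly `t` elements, so none properly contains another. -/
theorem mem_facets_iff
    (hx : ∀ j, ∀ k < s j + t - 1, ∀ j', ∀ k' < s j' + t - 1, x j k = x j' k' → j = j' ∧ k = k')
    (hΓ : ∀ F, F ∈ Γ ↔ ∃ j, ∃ k < s j, F ⊆ (Finset.Ico k (k + t)).image (x j)) (F : Finset V) :
    F ∈ Γ.facets ↔ ∃ j, ∃ k < s j, F = (Finset.Ico k (k + t)).image (x j) := by
  have hcard : ∀ j, ∀ k < s j, ((Finset.Ico k (k + t)).image (x j)).card = t := by
    intro j k hk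
    rw [Finset.card_image_of_injOn, Nat.card_Ico, Nat.add_sub_cancel_left]
    intro i hi i' hi' h
    rw [Finset.coe_Ico, Set.mem_Ico] at hi hi'
    exact (hx j i (by omega) j i' (by omega) h).2
  constructor
  · rintro ⟨hF, hmax⟩
    obtain ⟨j, k, hk, hFk⟩ := (hΓ F).1 hF
    exact ⟨j, k, hk, hFk.antisymm (hmax ((hΓ _).2 ⟨j, k, hk, subset_rfl⟩) hFk)⟩
  · rintro ⟨j, k, hk, rfl⟩
    refine ⟨(hΓ _).2 ⟨j, k, hk, subset_rfl⟩, fun G hG hle => ?_⟩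
    obtain ⟨j', k', hk', hG⟩ := (hΓ G).1 hG
    refine (Finset.eq_of_subset_of_card_le hle ?_).ge
    rw [hcard j k hk, ← hcard j' k' hk']
    exact Finset.card_le_card hG

theorem mem_vertexSet_iff (ht : 1 ≤ t) (hs : ∀ j, 1 ≤ s j)
    (hΓ : ∀ F, F ∈ Γ ↔ ∃ j, ∃ k < s j, F ⊆ (Finset.Ico k (k + t)).image (x j)) (v : V) :
    v ∈ Γ.vertexSet ↔ ∃ j, ∃ k < s j + t - 1, x j k = v := by
  rw [vertexSet, Set.mem_ofPred_eq, hΓ]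
  simp only [Finset.singleton_subset_iff, Finset.mem_image, Finset.mem_Ico]
  refine exists_congr fun j => ⟨?_, ?_⟩
  · rintro ⟨k, hk, i, hi, rfl⟩
    exact ⟨i, by omega, rfl⟩
  · rintro ⟨i, hi, rfl⟩
    have := hs j
    -- A vertex lies in the block it starts, or in the last block if it starts none.
    exact ⟨min i (s j - 1), by omega, i, by omega, rfl⟩

/-- A set of vertices lies in `Y \ F` exactly when it misses `F`; so not being a face means meeting
every facet. -/
theorem mem_hits_iff_notMem_complement
    (hx : ∀ j, ∀ k < s j + t - 1, ∀ j', ∀ k' < s j' + t - 1, x j k = x j' k' → j = j' ∧ k = k')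
    (hΓ : ∀ F, F ∈ Γ ↔ ∃ j, ∃ k < s j, F ⊆ (Finset.Ico k (k + t)).image (x j)) (G : Finset V) :
    G ∈ {G | G ∈ (Γ.vertexSimplex : Set (Finset V)) ∧ ∀ j, Hits t (x j) 0 (s j) G} ↔
      G ∈ Γ.vertexSimplex ∧ G ∉ Γ.complement := by
  refine and_congr_right fun hG => ?_
  have hcompl : G ∈ Γ.complement ↔
      ∃ j, ∃ k < s j, ∀ v ∈ G, v ∉ (Finset.Ico k (k + t)).image (x j) := by
    constructor
    · rintro ⟨F, hF, hGF⟩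
      obtain ⟨j, k, hk, rfl⟩ := (mem_facets_iff hx hΓ F).1 hF
      exact ⟨j, k, hk, fun v hv => (hGF hv).2⟩
    · rintro ⟨j, k, hk, h⟩
      exact ⟨_, (mem_facets_iff hx hΓ _).2 ⟨j, k, hk, rfl⟩, fun v hv => ⟨hG hv, h v hv⟩⟩
  rw [hcompl]
  push Not
  refine forall_congr' fun j => forall₂_congr fun k hk => ?_
  simp only [Finset.mem_image, Finset.mem_Ico, zero_add]
  constructor
  · rintro ⟨i, hi, hxi⟩
    exact ⟨_, hxi, k + i, by omega, rfl⟩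
  · rintro ⟨_, hv, i, hi, rfl⟩
    exact ⟨i - k, by omega, by rwa [show k + (i - k) = i by omega]⟩

variable (K : Type*) [Field K]

theorem exactAt_vertexSimplex {v : V} (hv : v ∈ Γ.vertexSet) (m : ℤ) :
    ExactAt K Γ.vertexSimplex ⊥ m := by
  refine exactAt_of_cone v (fun F hF _ => ?_) (fun F _ _ => by simp) m
  rw [mem_vertexSimplex, Finset.coe_insert]
  exact Set.insert_subset hv hF

theorem indepOf_vertexSimplex {v : V} (hv : v ∈ Γ.vertexSet) :
    IndepOf (Γ.vertexSimplex : Set (Finset V)) v := by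
  intro G
  simp only [SetLike.mem_coe, mem_vertexSimplex, Finset.coe_insert, Set.insert_subset_iff, hv,
    true_and]

theorem IsDisjointUnionOfRuns.subsingleton_reducedHomology (ht : 2 ≤ t) (hs : ∀ j, 1 ≤ s j)
    {i : ι} (hs1 : s i % (t + 1) ≠ 1) (hs2 : s i % (t + 1) ≠ 2)
    (h : Γ.IsDisjointUnionOfRuns t s) (m : ℤ) :
    Subsingleton (ReducedHomology K Γ.complement m) := by
  obtain ⟨x, hx, hΓ⟩ := h.exists_vertices ht
  have hv : ∀ j, ∀ k < s j + t - 1, x j k ∈ Γ.vertexSet := fun j k hk =>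
    (mem_vertexSet_iff (by omega) hs hΓ _).2 ⟨j, k, hk, rfl⟩
  have hred := reducesTo_empty_of_exists_mod K ht (hs i) hs1 hs2 hx
    (fun j k hk => indepOf_vertexSimplex (hv j k hk))
  have hex := (hred (m + 1)).1 (familyExactAt_empty _) _ _ (complement_le_vertexSimplex Γ)
    (mem_hits_iff_notMem_complement hx hΓ)
  have := hs i
  exact FaceComplex.subsingleton_reducedHomology (hex.shift bot_le
    (exactAt_vertexSimplex K (hv i 0 (by omega))) (complement_le_vertexSimplex Γ))

theorem IsDisjointUnionOfRuns.exists_reducesTo_singleton [Fintype ι] (ht : 2 ≤ t)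
    (hs : ∀ j, s j % (t + 1) = 1 ∨ s j % (t + 1) = 2) (h : Γ.IsDisjointUnionOfRuns t s) :
    ∃ G : Finset V, G.card = ∑ j, (2 * (s j / (t + 1)) + s j % (t + 1)) ∧
      ReducesTo K {F | F ∈ Γ.vertexSimplex ∧ F ∉ Γ.complement} {G} := by
  classical
  have hs1 : ∀ j, 1 ≤ s j := fun j => by
    have := Nat.mod_le (s j) (t + 1)
    rcases hs j with h | h <;> omega
  obtain ⟨x, hx, hΓ⟩ := h.exists_vertices ht
  have hv : ∀ j, ∀ k < s j + t - 1, x j k ∈ Γ.vertexSet := fun j k hk =>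
    (mem_vertexSet_iff (by omega) hs1 hΓ _).2 ⟨j, k, hk, rfl⟩
  obtain ⟨R, hR, hred⟩ := exists_reducesTo_traces K ht hs hx
    (fun j k hk => indepOf_vertexSimplex (hv j k hk))
  have hRlt : ∀ j, ∀ k ∈ R j, k < s j + t - 1 := fun j k hk => Finset.mem_range.1 ((hR j).1 hk)
  set G : Finset V := (Finset.univ.sigma R).image fun p => x p.1 p.2 with hG
  have hmem : ∀ j, ∀ k < s j + t - 1, x j k ∈ G ↔ k ∈ R j := by
    intro j k hk
    simp only [hG, Finset.mem_image, Finset.mem_sigma, Finset.mem_univ, true_and, Sigma.exists]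
    constructor
    · rintro ⟨j', k', hk', h⟩
      obtain ⟨rfl, rfl⟩ := hx j' k' (hRlt j' k' hk') j k hk h
      exact hk'
    · exact fun hk' => ⟨j, k, hk', rfl⟩
  refine ⟨G, ?_, ?_⟩
  · rw [hG, Finset.card_image_of_injOn, Finset.card_sigma]
    · exact Finset.sum_congr rfl fun j _ => (hR j).2
    · rintro ⟨j, k⟩ hk ⟨j', k'⟩ hk' h
      simp only [Finset.coe_sigma, Set.mem_sigma_iff, Finset.mem_coe] at hk hk'
      obtain ⟨rfl, rfl⟩ := hx j k (hRlt j k hk.2) j' k' (hRlt j' k' hk'.2) h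
      rfl
  -- With every run treated, the trace on all of `Y` is prescribed, so `G` is the only set left.
  · convert hred Finset.univ using 1
    · ext F
      exact (mem_hits_iff_notMem_complement hx hΓ F).symm
    · ext F
      simp only [Set.mem_singleton_iff, Set.mem_ofPred_eq, Finset.mem_univ, not_true_eq_false,
        false_imp_iff, implies_true, and_true, forall_const, SetLike.mem_coe, mem_vertexSimplex]
      constructor
      · rintro rfl
        refine ⟨fun v hvG => ?_, hmem⟩
        obtain ⟨p, hp, rfl⟩ := Finset.mem_image.1 hvG
        exact hv _ _ (hRlt _ _ (Finset.mem_sigma.1 hp).2)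
      · rintro ⟨hFv, hF⟩
        ext v
        by_cases hvΓ : v ∈ Γ.vertexSet
        · obtain ⟨j, k, hk, rfl⟩ := (mem_vertexSet_iff (by omega) hs1 hΓ v).1 hvΓ
          rw [hF j k hk, hmem j k hk]
        · refine iff_of_false (fun h => hvΓ (hFv h)) fun h => hvΓ ?_
          obtain ⟨p, hp, rfl⟩ := Finset.mem_image.1 h
          exact hv _ _ (hRlt _ _ (Finset.mem_sigma.1 hp).2)

theorem IsDisjointUnionOfRuns.reducedHomology [Fintype ι] [Nonempty ι] (ht : 2 ≤ t)
    (hs : ∀ j, s j % (t + 1) = 1 ∨ s j % (t + 1) = 2) (h : Γ.IsDisjointUnionOfRuns t s) (m : ℤ) :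
    (m = (∑ j, (2 * (s j / (t + 1)) + s j % (t + 1)) : ℕ) - 2 →
      Nonempty (ReducedHomology K Γ.complement m ≃ₗ[K] K)) ∧
    (m ≠ (∑ j, (2 * (s j / (t + 1)) + s j % (t + 1)) : ℕ) - 2 →
      Subsingleton (ReducedHomology K Γ.complement m)) := by
  obtain ⟨G, hcard, hred⟩ := h.exists_reducesTo_singleton K ht hs
  have hle := complement_le_vertexSimplex Γ
  obtain ⟨v, hv⟩ : Γ.vertexSet.Nonempty := by
    obtain ⟨x, hx, hΓ⟩ := h.exists_vertices ht
    obtain ⟨j⟩ := ‹Nonempty ι›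
    have hsj : s j ≠ 0 := fun h0 => by
      have := hs j
      simp [h0] at this
    refine ⟨x j 0, (hΓ _).2 ⟨j, 0, by omega, ?_⟩⟩
    simp only [Finset.singleton_subset_iff, Finset.mem_image, Finset.mem_Ico]
    exact ⟨0, by omega, rfl⟩
  rw [← hcard]
  constructor
  · rintro rfl
    refine nonempty_reducedHomology_equiv (OneDimAt.shift hle bot_le
      (exactAt_vertexSimplex K hv) ?_)
    rw [show (G.card : ℤ) - 2 + 1 = G.card - 1 by ring]
    exact (hred _).2 (familyOneDimAt_singleton G) _ _ hle fun F => Iff.rfl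
  · intro hm
    refine FaceComplex.subsingleton_reducedHomology (ExactAt.shift bot_le
      (exactAt_vertexSimplex K hv) hle ?_)
    exact (hred _).1 (familyExactAt_singleton G (by omega)) _ _ hle fun F => Iff.rfl

end Complement

end FaceComplex

/-! ### Evaluation of the degree for the two residues. -/

theorem mainTheorem6 {K : Type*} [Field K] {V : Type*} [LinearOrder V] (t : ℕ) (ht : 2 ≤ t) :
    (∀ (α β : ℕ) (p : Fin α → ℕ) (q : Fin β → ℕ), 1 ≤ α + β →
      ∀ Γ : FaceComplex V,
        Γ.IsDisjointUnionOfRuns t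
          (Sum.elim (fun j => (t + 1) * p j + 1) (fun j => (t + 1) * q j + 2)) →
        ∀ i : ℤ,
          (i = 2 * ((∑ j, p j : ℕ) + (∑ j, q j : ℕ)) + 2 * β + α - 2 →
            Nonempty (FaceComplex.ReducedHomology K Γ.complement i ≃ₗ[K] K)) ∧
          (i ≠ 2 * ((∑ j, p j : ℕ) + (∑ j, q j : ℕ)) + 2 * β + α - 2 →
            Subsingleton (FaceComplex.ReducedHomology K Γ.complement i))) ∧
    (∀ (r : ℕ) (s : Fin r → ℕ), (∀ j, 1 ≤ s j) →
      (∃ j, s j % (t + 1) ≠ 1 ∧ s j % (t + 1) ≠ 2) →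
      ∀ Γ : FaceComplex V, Γ.IsDisjointUnionOfRuns t s →
        ∀ i : ℤ, Subsingleton (FaceComplex.ReducedHomology K Γ.complement i)) := by
  refine ⟨fun α β p q hαβ Γ hΓ i => ?_, fun r s hs ⟨j, hj1, hj2⟩ Γ hΓ i =>
    hΓ.subsingleton_reducedHomology K ht hs hj1 hj2 i⟩
  have h1 : ∀ a, ((t + 1) * a + 1) % (t + 1) = 1 := fun a => by
    rw [Nat.mul_add_mod, Nat.mod_eq_of_lt (by omega)]
  have h2 : ∀ a, ((t + 1) * a + 2) % (t + 1) = 2 := fun a => by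
    rw [Nat.mul_add_mod, Nat.mod_eq_of_lt (by omega)]
  have d1 : ∀ a, ((t + 1) * a + 1) / (t + 1) = a := fun a => by
    rw [Nat.mul_add_div (by omega), Nat.div_eq_of_lt (by omega), add_zero]
  have d2 : ∀ a, ((t + 1) * a + 2) / (t + 1) = a := fun a => by
    rw [Nat.mul_add_div (by omega), Nat.div_eq_of_lt (by omega), add_zero]
  have : Nonempty (Fin α ⊕ Fin β) := by
    rw [← Fintype.card_pos_iff, Fintype.card_sum, Fintype.card_fin, Fintype.card_fin]
    omega
  have key := hΓ.reducedHomology K ht (by rintro (j | j) <;> simp [h1, h2]) i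
  have hsum : ((∑ j, (2 * (Sum.elim (fun j => (t + 1) * p j + 1) (fun j => (t + 1) * q j + 2) j /
      (t + 1)) + Sum.elim (fun j => (t + 1) * p j + 1) (fun j => (t + 1) * q j + 2) j % (t + 1)) :
      ℕ) : ℤ) - 2 = 2 * ((∑ j, p j : ℕ) + (∑ j, q j : ℕ)) + 2 * β + α - 2 := by
    simp only [Fintype.sum_sum_type, Sum.elim_inl, Sum.elim_inr, h1, h2, d1, d2,
      Finset.sum_add_distrib, ← Finset.mul_sum, Finset.sum_const, Finset.card_univ,
      Fintype.card_fin, smul_eq_mul]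
    push_cast
    ring
  rwa [hsum] at key
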